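/- Let $H$ be a complex Hilbert space and let $B_s(H)$ denote the real vector space of all bounded self-adjoint linear operators on $H$. Let $\phi: B_s(H)\to B_s(H)$ be a bijective (real-)linear map which preserves the operator norm, that is, $\|\phi(A)\|=\|A\|$ for every $A\in B_s(H)$. Then there is an either unitary or antiunitary operator $U$ on $H$ such that either $\phi(A)=UAU^*$ for every $A\in B_s(H)$, or $\phi(A)=-UAU^*$ for every $A\in B_s(H)$. Here an antiunitary operator on $H$ is a norm preserving conjugate-linear bijection $U:H\to H$, and the adjoint $U^*$ of a bounded conjugate-linear operator $U$ is the bounded conjugate-linear operator determined by $\langle U^*y,x\rangle=\langle Ux,y\rangle$ for all $x,y\in H$. -/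

import Mathlib

open scoped InnerProductSpace

/-- An antiunitary operator on `H`: a norm preserving conjugate-linear bijection of `H`. -/
def IsAntiunitary {H : Type*} [NormedAddCommGroup H] [InnerProductSpace ℂ H]
    (U : H →L⋆[ℂ] H) : Prop :=
  Function.Bijective U ∧ ∀ x : H, ‖U x‖ = ‖x‖

/-- The adjoint `T*` of a bounded conjugate-linear operator `T`: it sends `y` to the Riesz
representative of the bounded linear functional `x ↦ conj ⟪y, T x⟫`. Equivalently, it is the
bounded conjugate-linear operator with `⟪T* y, x⟫ = ⟪T x, y⟫`; see `inner_conjAdjoint_left`. -/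
noncomputable def conjAdjoint {H : Type*} [NormedAddCommGroup H] [InnerProductSpace ℂ H]
    [CompleteSpace H] (T : H →L⋆[ℂ] H) : H →L⋆[ℂ] H :=
  LinearMap.mkContinuous
    { toFun := fun y => (InnerProductSpace.toDual ℂ H).symm
        ((starL ℂ : ℂ ≃L⋆[ℂ] ℂ).toContinuousLinearMap.comp ((innerSL ℂ y).comp T))
      map_add' := fun y z => by
        apply ext_inner_right ℂ
        intro x
        simp [inner_add_left]
      map_smul' := fun c y => by
        apply ext_inner_right ℂ
        intro x
        simp [inner_smul_left] }
    ‖T‖ (fun y => by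
      simp only [LinearMap.coe_mk, AddHom.coe_mk, LinearIsometryEquiv.norm_map]
      refine ContinuousLinearMap.opNorm_le_bound _ (by positivity) (fun x => ?_)
      have h1 : ‖⟪y, T x⟫_ℂ‖ ≤ ‖y‖ * ‖T x‖ := norm_inner_le_norm y (T x)
      have h2 : ‖y‖ * ‖T x‖ ≤ ‖y‖ * (‖T‖ * ‖x‖) :=
        mul_le_mul_of_nonneg_left (T.le_opNorm x) (norm_nonneg y)
      simp only [ContinuousLinearMap.comp_apply, ContinuousLinearEquiv.coe_coe, starL_apply,
        norm_star, innerSL_apply_apply]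
      linarith)

theorem inner_conjAdjoint_left {H : Type*} [NormedAddCommGroup H] [InnerProductSpace ℂ H]
    [CompleteSpace H] (T : H →L⋆[ℂ] H) (x y : H) :
    ⟪conjAdjoint T y, x⟫_ℂ = ⟪T x, y⟫_ℂ := by
  simp [conjAdjoint]

/-! The norm determines the unit up to sign, the unit and the norm determine the order, and the
order determines rays and quadratic forms; a Wigner-type argument then produces `U`. The identity
satisfies `max ‖1 + A‖ ‖1 - A‖ = 1 + ‖A‖`, and testing this on rank one projections singles out
`±1`, so `φ 1 = ±1` (`map_one_eq_one_or_neg_one`). After a change of sign `φ` is unital, hence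
positive in both directions. Positive rank one operators are the positive `A` for which every `0 ≤ B
≤ A` is a multiple of `A`, so `φ` permutes them; the value `⟪A x, x⟫` can also be read off from the
order, so it is preserved along this correspondence (`quadForm_map_eq`). To build `U`, fix a unit
vector `e` with image `e'`. Linearity of `φ` on the polarized operators `symRankOne e x` yields a
real-linear isometry on the orthogonal complement of `e`. It commutes or anticommutes with `i`,
uniformly, and sending `e` to `e'` extends it to a linear or conjugate-linear `U` with `φ
(rankOneSelf z) = rankOneSelf (U z)`. Quadratic forms then give the formula for every `A`. -/

/-- A group is not the union of two proper subgroups, here two kernels. This makes pointwise choices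
of sign uniform. -/
theorem forall_or_forall_of_forall_or {G M : Type*} [AddCommGroup G] [AddCommGroup M]
    (f g : G →+ M) (h : ∀ x, f x = 0 ∨ g x = 0) : (∀ x, f x = 0) ∨ ∀ x, g x = 0 := by
  by_contra! hc
  obtain ⟨⟨x, hx⟩, y, hy⟩ := hc
  have hgx := (h x).resolve_left hx
  have hfy := (h y).resolve_right hy
  rcases h (x + y) with h1 | h1 <;> simp_all

theorem norm_sq_eq_of_norm_eq_one {H : Type*} [NormedAddCommGroup H]
    [InnerProductSpace ℂ H] {x : H} (hx : ‖x‖ = 1) (z : H) :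
    ‖z‖ ^ 2 = ‖⟪x, z⟫_ℂ‖ ^ 2 + ‖z - ⟪x, z⟫_ℂ • x‖ ^ 2 := by
  have h : ⟪⟪x, z⟫_ℂ • x, z - ⟪x, z⟫_ℂ • x⟫_ℂ = 0 := by
    have hxx : ⟪x, x⟫_ℂ = 1 := by simp [inner_self_eq_norm_sq_to_K, hx]
    rw [inner_smul_left, inner_sub_right, inner_smul_right, hxx, mul_one, sub_self, mul_zero]
  have h2 := norm_add_sq_eq_norm_sq_add_norm_sq_of_inner_eq_zero _ _ h
  rw [add_sub_cancel, norm_smul, hx, mul_one] at h2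
  rw [sq, h2]; ring

/-! ### Quadratic forms of self-adjoint operators -/

section SelfAdjointIsometry

variable {H : Type*} [NormedAddCommGroup H] [InnerProductSpace ℂ H] [CompleteSpace H]

/-- The quadratic form of a bounded self-adjoint operator. -/
noncomputable def quadForm (A : selfAdjoint (H →L[ℂ] H)) (x : H) : ℝ :=
  (⟪(A : H →L[ℂ] H) x, x⟫_ℂ).re

/-- The rank one operator `z ↦ ⟪x, z⟫ x`. -/
noncomputable def rankOneSelf (x : H) : selfAdjoint (H →L[ℂ] H) :=
  ⟨InnerProductSpace.rankOne ℂ x x, by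
    rw [selfAdjoint.mem_iff, ContinuousLinearMap.star_eq_adjoint,
      InnerProductSpace.adjoint_rankOne]⟩

theorem rankOneSelf_apply (x z : H) : (rankOneSelf x : H →L[ℂ] H) z = ⟪x, z⟫_ℂ • x := rfl

theorem norm_rankOneSelf (x : H) : ‖(rankOneSelf x : H →L[ℂ] H)‖ = ‖x‖ ^ 2 := by
  simp [rankOneSelf, sq]

theorem inner_selfAdjoint_apply (A : selfAdjoint (H →L[ℂ] H)) (x y : H) :
    ⟪(A : H →L[ℂ] H) x, y⟫_ℂ = ⟪x, (A : H →L[ℂ] H) y⟫_ℂ := by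
  have h : ContinuousLinearMap.adjoint (A : H →L[ℂ] H) = A := A.2
  conv_lhs => rw [← h]
  exact ContinuousLinearMap.adjoint_inner_left _ _ _

theorem quadForm_eq_inner (A : selfAdjoint (H →L[ℂ] H)) (x : H) :
    ((quadForm A x : ℝ) : ℂ) = ⟪(A : H →L[ℂ] H) x, x⟫_ℂ := by
  apply Complex.conj_eq_iff_re.1
  rw [inner_conj_symm, inner_selfAdjoint_apply]

theorem quadForm_add (A B : selfAdjoint (H →L[ℂ] H)) (x : H) :
    quadForm (A + B) x = quadForm A x + quadForm B x := by
  simp [quadForm]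

theorem quadForm_sub (A B : selfAdjoint (H →L[ℂ] H)) (x : H) :
    quadForm (A - B) x = quadForm A x - quadForm B x := by
  simp [quadForm]

theorem quadForm_neg (A : selfAdjoint (H →L[ℂ] H)) (x : H) :
    quadForm (-A) x = -quadForm A x := by
  simp [quadForm]

theorem coe_real_smul_apply (t : ℝ) (A : selfAdjoint (H →L[ℂ] H)) (x : H) :
    ((t • A : selfAdjoint (H →L[ℂ] H)) : H →L[ℂ] H) x = (t : ℂ) • (A : H →L[ℂ] H) x := by
  simp

theorem quadForm_smul (t : ℝ) (A : selfAdjoint (H →L[ℂ] H)) (x : H) :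
    quadForm (t • A) x = t * quadForm A x := by
  rw [quadForm, coe_real_smul_apply, inner_smul_left]
  simp [quadForm]

theorem quadForm_one (x : H) : quadForm (1 : selfAdjoint (H →L[ℂ] H)) x = ‖x‖ ^ 2 := by
  simp [quadForm, inner_self_eq_norm_sq_to_K, ← Complex.ofReal_pow]

theorem quadForm_rankOneSelf (x z : H) : quadForm (rankOneSelf x) z = ‖⟪x, z⟫_ℂ‖ ^ 2 := by
  rw [quadForm, rankOneSelf_apply, inner_smul_left, Complex.conj_mul', ← Complex.ofReal_pow,
    Complex.ofReal_re]

theorem quadForm_apply_smul (A : selfAdjoint (H →L[ℂ] H)) (c : ℂ) (x : H) :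
    quadForm A (c • x) = ‖c‖ ^ 2 * quadForm A x := by
  simp only [quadForm, map_smul, inner_smul_left, inner_smul_right]
  rw [← mul_assoc, Complex.mul_conj', ← Complex.ofReal_pow, Complex.re_ofReal_mul]

theorem quadForm_apply_add (A : selfAdjoint (H →L[ℂ] H)) (x y : H) :
    quadForm A (x + y) =
      quadForm A x + 2 * (⟪(A : H →L[ℂ] H) x, y⟫_ℂ).re + quadForm A y := by
  have h : (⟪(A : H →L[ℂ] H) y, x⟫_ℂ).re = (⟪(A : H →L[ℂ] H) x, y⟫_ℂ).re := by
    rw [inner_selfAdjoint_apply, ← inner_conj_symm, Complex.conj_re]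
  simp only [quadForm, map_add, inner_add_left, inner_add_right, Complex.add_re, h]
  ring

theorem abs_quadForm_le (A : selfAdjoint (H →L[ℂ] H)) (x : H) :
    |quadForm A x| ≤ ‖(A : H →L[ℂ] H)‖ * ‖x‖ ^ 2 := by
  calc |quadForm A x| ≤ ‖⟪(A : H →L[ℂ] H) x, x⟫_ℂ‖ := Complex.abs_re_le_norm _
    _ ≤ ‖(A : H →L[ℂ] H) x‖ * ‖x‖ := norm_inner_le_norm _ _
    _ ≤ ‖(A : H →L[ℂ] H)‖ * ‖x‖ * ‖x‖ := by gcongr; exact ContinuousLinearMap.le_opNorm _ _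
    _ = _ := by ring

theorem norm_le_of_abs_quadForm_le (A : selfAdjoint (H →L[ℂ] H)) {c : ℝ} (hc : 0 ≤ c)
    (h : ∀ x, |quadForm A x| ≤ c * ‖x‖ ^ 2) : ‖(A : H →L[ℂ] H)‖ ≤ c := by
  have hs : (A : H →L[ℂ] H).IsSymmetric := fun x y => inner_selfAdjoint_apply A x y
  rw [ContinuousLinearMap.norm_eq_iSup_rayleighQuotient _ hs]
  refine ciSup_le fun x => ?_
  have h1 := h x
  rw [ContinuousLinearMap.rayleighQuotient, abs_div, abs_of_nonneg (sq_nonneg ‖x‖)]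
  exact div_le_of_le_mul₀ (by positivity) hc h1

theorem eq_of_quadForm_eq {A B : selfAdjoint (H →L[ℂ] H)} (h : ∀ x, quadForm A x = quadForm B x) :
    A = B := by
  have h1 : ‖((A - B : selfAdjoint (H →L[ℂ] H)) : H →L[ℂ] H)‖ ≤ 0 :=
    norm_le_of_abs_quadForm_le _ le_rfl fun x => by simp [quadForm_sub, h x]
  have h2 : ((A - B : selfAdjoint (H →L[ℂ] H)) : H →L[ℂ] H) = 0 := norm_le_zero_iff.1 h1
  exact sub_eq_zero.1 (Subtype.ext h2)

/-- Cauchy–Schwarz for the semi-inner product `⟪A x, y⟫`. -/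
theorem norm_inner_sq_le_quadForm_mul {A : selfAdjoint (H →L[ℂ] H)} (hA : ∀ x, 0 ≤ quadForm A x)
    (x y : H) : ‖⟪(A : H →L[ℂ] H) x, y⟫_ℂ‖ ^ 2 ≤ quadForm A x * quadForm A y := by
  let c : PreInnerProductSpace.Core ℂ H :=
    { inner := fun x y => ⟪(A : H →L[ℂ] H) x, y⟫_ℂ
      conj_inner_symm := fun x y => by
        rw [inner_conj_symm, inner_selfAdjoint_apply]
      re_inner_nonneg := fun x => hA x
      add_left := fun x y z => by simp
      smul_left := fun x y r => by simp [mul_comm] }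
  have h := @InnerProductSpace.Core.inner_mul_inner_self_le ℂ H _ _ _ c x y
  have h2 : ‖⟪(A : H →L[ℂ] H) y, x⟫_ℂ‖ = ‖⟪(A : H →L[ℂ] H) x, y⟫_ℂ‖ := by
    rw [inner_selfAdjoint_apply, norm_inner_symm]
  calc _ = ‖⟪(A : H →L[ℂ] H) x, y⟫_ℂ‖ * ‖⟪(A : H →L[ℂ] H) y, x⟫_ℂ‖ := by rw [h2, sq]
    _ ≤ _ := h

/-- Adding a large multiple of a rank one projection `x ⊗ x` to `A` pushes the top of the
numerical range no further than `⟪A x, x⟫` predicts. -/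
theorem exists_quadForm_add_le {A : selfAdjoint (H →L[ℂ] H)} {x : H} (hx : ‖x‖ = 1) {c : ℝ}
    (hc : quadForm A x < c) :
    ∃ t : ℝ, 1 ≤ t ∧ ∀ z, quadForm A z + t * ‖⟪x, z⟫_ℂ‖ ^ 2 ≤ (c + t) * ‖z‖ ^ 2 := by
  set M := ‖(A : H →L[ℂ] H)‖ with hM
  have hM0 : 0 ≤ M := norm_nonneg _
  set d := c - quadForm A x with hd
  have hd0 : 0 < d := by linarith
  -- Split `z = a • x + w` with `w` orthogonal to `x`. In the value of `t`, `M ^ 2 / d` absorbs the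
  -- cross term by AM-GM, `M` bounds the form on `w`, and `1 + |c|` compensates a negative `c`.
  refine ⟨1 + |c| + M + M ^ 2 / d, ?_, fun z => ?_⟩
  · have : 0 ≤ M ^ 2 / d := by positivity
    have := abs_nonneg c
    linarith
  rw [norm_sq_eq_of_norm_eq_one hx z]
  set a := ⟪x, z⟫_ℂ with ha
  set w := z - a • x with hw
  have hz : z = a • x + w := by rw [hw]; abel
  have hq : quadForm A z ≤ ‖a‖ ^ 2 * quadForm A x + 2 * (M * ‖a‖ * ‖w‖) + M * ‖w‖ ^ 2 := by
    rw [hz, quadForm_apply_add, quadForm_apply_smul]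
    have h1 : (⟪(A : H →L[ℂ] H) (a • x), w⟫_ℂ).re ≤ M * ‖a‖ * ‖w‖ := by
      calc _ ≤ ‖⟪(A : H →L[ℂ] H) (a • x), w⟫_ℂ‖ := Complex.re_le_norm _
        _ ≤ ‖(A : H →L[ℂ] H) (a • x)‖ * ‖w‖ := norm_inner_le_norm _ _
        _ ≤ M * ‖a • x‖ * ‖w‖ := by gcongr; exact ContinuousLinearMap.le_opNorm _ _
        _ = _ := by rw [norm_smul, hx, mul_one]
    have h2 := (abs_le.1 (abs_quadForm_le A w)).2
    linarith
  have hqx : quadForm A x = c - d := by rw [hd]; ring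
  have key : 2 * (M * ‖a‖ * ‖w‖) ≤ d * ‖a‖ ^ 2 + M ^ 2 / d * ‖w‖ ^ 2 := by
    have h3 : 0 ≤ (d * ‖a‖ - M * ‖w‖) ^ 2 / d := by positivity
    have h4 : (d * ‖a‖ - M * ‖w‖) ^ 2 / d =
        d * ‖a‖ ^ 2 + M ^ 2 / d * ‖w‖ ^ 2 - 2 * (M * ‖a‖ * ‖w‖) := by
      field_simp; ring
    linarith
  have hcw : 0 ≤ (1 + |c| + c) * ‖w‖ ^ 2 := by
    have := neg_abs_le c
    exact mul_nonneg (by linarith) (sq_nonneg _)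
  rw [hqx] at hq
  nlinarith [hq, key, hcw]

/-- A self-adjoint operator `J` of norm one with `max ‖J + A‖ ‖J - A‖ = 1 + ‖A‖` for all rank one
projections `A` is `1` or `-1`. -/
theorem eq_one_or_neg_one_of_rankOneSelf {J : selfAdjoint (H →L[ℂ] H)}
    (hJ : ‖(J : H →L[ℂ] H)‖ ≤ 1)
    (h : ∀ x : H, ‖x‖ = 1 → 2 ≤ ‖((J + rankOneSelf x : selfAdjoint (H →L[ℂ] H)) : H →L[ℂ] H)‖ ∨
      2 ≤ ‖((J - rankOneSelf x : selfAdjoint (H →L[ℂ] H)) : H →L[ℂ] H)‖) :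
    J = 1 ∨ J = -1 := by
  have key : ∀ K : selfAdjoint (H →L[ℂ] H), ‖(K : H →L[ℂ] H)‖ ≤ 1 → ∀ x : H, ‖x‖ = 1 →
      2 ≤ ‖((K + rankOneSelf x : selfAdjoint (H →L[ℂ] H)) : H →L[ℂ] H)‖ →
      (K : H →L[ℂ] H) x = x := by
    intro K hK x hx h2
    have hKz : ∀ z, |quadForm K z| ≤ ‖z‖ ^ 2 := fun z =>
      (abs_quadForm_le K z).trans (mul_le_of_le_one_left (sq_nonneg _) hK)
    have h1 : 1 ≤ quadForm K x := by
      by_contra! hlt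
      obtain ⟨c, hc1, hc2⟩ := exists_between hlt
      obtain ⟨t, ht, hz⟩ := exists_quadForm_add_le hx hc1
      have ht0 : 0 < t := by linarith
      -- With `P = rankOneSelf x`, weighting `K + t P ≤ c + t` by `1 / t` and `K ≤ 1` by `1 - 1 / t`
      -- gives `K + P ≤ 2 - (1 - c) / t`. The `1` in the maximum covers the lower bound `K + P ≥
      -- -1`.
      set s := max 1 (2 - (1 - c) / t) with hs
      have hs2 : s < 2 := max_lt (by norm_num) (by
        have : 0 < (1 - c) / t := div_pos (by linarith) ht0
        linarith)
      have := norm_le_of_abs_quadForm_le (K + rankOneSelf x) (c := s)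
        (zero_le_one.trans (le_max_left _ _)) (fun z => by
          rw [quadForm_add, quadForm_rankOneSelf]
          have hk := abs_le.1 (hKz z)
          have hzz := hz z
          have hn : 0 ≤ ‖z‖ ^ 2 := sq_nonneg _
          rw [abs_le]
          constructor
          · have : 1 * ‖z‖ ^ 2 ≤ s * ‖z‖ ^ 2 :=
              mul_le_mul_of_nonneg_right (le_max_left _ _) hn
            have := sq_nonneg ‖⟪x, z⟫_ℂ‖
            linarith
          · have h3 : (2 - (1 - c) / t) * ‖z‖ ^ 2 ≤ s * ‖z‖ ^ 2 :=
              mul_le_mul_of_nonneg_right (le_max_right _ _) hn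
            refine le_trans ?_ h3
            have h4 : (2 - (1 - c) / t) * ‖z‖ ^ 2 = ((2 * t - 1 + c) * ‖z‖ ^ 2) / t := by
              field_simp; ring
            rw [h4, le_div_iff₀ ht0]
            nlinarith [mul_le_mul_of_nonneg_left hk.2 (sub_nonneg.2 ht)])
      linarith
    have hKx : ‖(K : H →L[ℂ] H) x‖ ≤ 1 := by
      simpa [hx] using (ContinuousLinearMap.le_opNorm (K : H →L[ℂ] H) x).trans
        (mul_le_of_le_one_left (norm_nonneg x) hK)
    -- Equality case of Cauchy–Schwarz: `‖K x‖ ≤ 1` and `⟪K x, x⟫ ≥ 1` force `K x = x`.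
    have h5 := @norm_sub_sq ℂ _ _ _ _ ((K : H →L[ℂ] H) x) x
    have h6 : RCLike.re ⟪(K : H →L[ℂ] H) x, x⟫_ℂ = quadForm K x := rfl
    rw [h6, hx] at h5
    have h7 : ‖(K : H →L[ℂ] H) x‖ ^ 2 ≤ 1 := pow_le_one₀ (norm_nonneg _) hKx
    have h8 : ‖(K : H →L[ℂ] H) x - x‖ ^ 2 ≤ 0 := by rw [h5]; linarith
    have h9 : ‖(K : H →L[ℂ] H) x - x‖ = 0 := by
      simpa using le_antisymm h8 (sq_nonneg _)
    exact sub_eq_zero.1 (norm_eq_zero.1 h9)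
  have hunit : ∀ x : H, ‖x‖ = 1 → (J : H →L[ℂ] H) x = x ∨ (J : H →L[ℂ] H) x = -x := by
    intro x hx
    rcases h x hx with h1 | h1
    · exact .inl (key J hJ x hx h1)
    · right
      have := key (-J) (by simpa using hJ) x hx (by
        have e : ((-J + rankOneSelf x : selfAdjoint (H →L[ℂ] H)) : H →L[ℂ] H) =
            -((J - rankOneSelf x : selfAdjoint (H →L[ℂ] H)) : H →L[ℂ] H) := by
          push_cast
          abel
        rwa [e, norm_neg])
      rw [← neg_eq_iff_eq_neg]
      simpa using this
  have hall : ∀ x : H, (J : H →L[ℂ] H) x - x = 0 ∨ (J : H →L[ℂ] H) x + x = 0 := by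
    intro x
    by_cases hx : x = 0
    · simp [hx]
    have hn : ((‖x‖ : ℝ) : ℂ) ≠ 0 := by simpa using hx
    have hu : ‖((‖x‖ : ℝ) : ℂ)⁻¹ • x‖ = 1 := by
      rw [norm_smul, norm_inv, Complex.norm_real, norm_norm, inv_mul_cancel₀ (norm_ne_zero_iff.2 hx)]
    rcases hunit _ hu with h1 | h1
    · left
      rw [map_smul] at h1
      exact sub_eq_zero.2 (smul_right_injective H (inv_ne_zero hn) h1)
    · right
      rw [map_smul, ← smul_neg] at h1
      exact eq_neg_iff_add_eq_zero.1 (smul_right_injective H (inv_ne_zero hn) h1)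
  rcases forall_or_forall_of_forall_or
    (((J : H →L[ℂ] H) - 1 : H →L[ℂ] H) : H →+ H) (((J : H →L[ℂ] H) + 1 : H →L[ℂ] H) : H →+ H)
    (by simpa using hall) with h1 | h1
  · left
    ext x
    simpa [sub_eq_zero] using h1 x
  · right
    ext x
    simpa [eq_neg_iff_add_eq_zero] using h1 x

end SelfAdjointIsometry

/-! ### From the norm to the order -/

section SelfAdjointIsometry

set_option synthInstance.maxHeartbeats 200000

variable {H : Type*} [NormedAddCommGroup H] [InnerProductSpace ℂ H] [CompleteSpace H]

/-- Surjectivity writes each rank one projection as `φ A` with `‖A‖ = 1`. If both `‖1 ± A‖` were at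
most `m < 2`, the form of `A` would be bounded by `max 0 (m - 1) < 1`. -/
theorem map_one_eq_one_or_neg_one
    {φ : selfAdjoint (H →L[ℂ] H) →ₗ[ℝ] selfAdjoint (H →L[ℂ] H)} (hsurj : Function.Surjective φ)
    (hnorm : ∀ A : selfAdjoint (H →L[ℂ] H), ‖(φ A : H →L[ℂ] H)‖ = ‖(A : H →L[ℂ] H)‖) :
    φ 1 = 1 ∨ φ 1 = -1 := by
  refine eq_one_or_neg_one_of_rankOneSelf (by
    rw [hnorm]; exact ContinuousLinearMap.norm_id_le) fun x hx => ?_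
  obtain ⟨A, hA⟩ := hsurj (rankOneSelf x)
  have hA1 : ‖(A : H →L[ℂ] H)‖ = 1 := by rw [← hnorm, hA, norm_rankOneSelf, hx]; norm_num
  rw [← hA, ← map_add, ← map_sub, hnorm, hnorm, ← le_max_iff]
  by_contra! hlt
  set m := max ‖((1 + A : selfAdjoint (H →L[ℂ] H)) : H →L[ℂ] H)‖
    ‖((1 - A : selfAdjoint (H →L[ℂ] H)) : H →L[ℂ] H)‖ with hm
  have h := norm_le_of_abs_quadForm_le A (c := max 0 (m - 1)) (le_max_left _ _) fun z => by
    have hz : 0 ≤ ‖z‖ ^ 2 := sq_nonneg _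
    have h1 := (abs_le.1 (abs_quadForm_le (1 + A) z)).2
    have h2 := (abs_le.1 (abs_quadForm_le (1 - A) z)).2
    rw [quadForm_add, quadForm_one] at h1
    rw [quadForm_sub, quadForm_one] at h2
    have h3 := h1.trans (mul_le_mul_of_nonneg_right
      (le_max_left _ ‖((1 - A : selfAdjoint (H →L[ℂ] H)) : H →L[ℂ] H)‖) hz)
    have h4 := h2.trans (mul_le_mul_of_nonneg_right
      (le_max_right ‖((1 + A : selfAdjoint (H →L[ℂ] H)) : H →L[ℂ] H)‖ _) hz)
    rw [← hm] at h3 h4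
    have h5 : (m - 1) * ‖z‖ ^ 2 ≤ max 0 (m - 1) * ‖z‖ ^ 2 :=
      mul_le_mul_of_nonneg_right (le_max_right _ _) hz
    rw [abs_le]
    constructor <;> linarith
  rw [hA1] at h
  rcases le_max_iff.1 h with h | h <;> linarith

/-- With `c = ‖A‖`, positivity of `A` amounts to `‖c • 1 - A‖ ≤ c`, a condition that a unital linear
isometry preserves. -/
theorem quadForm_map_nonneg {φ : selfAdjoint (H →L[ℂ] H) →ₗ[ℝ] selfAdjoint (H →L[ℂ] H)}
    (hnorm : ∀ A : selfAdjoint (H →L[ℂ] H), ‖(φ A : H →L[ℂ] H)‖ = ‖(A : H →L[ℂ] H)‖)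
    (hone : φ 1 = 1) {A : selfAdjoint (H →L[ℂ] H)} (hA : ∀ x, 0 ≤ quadForm A x) (x : H) :
    0 ≤ quadForm (φ A) x := by
  set c := ‖(A : H →L[ℂ] H)‖ with hc
  have h1 : ‖((c • 1 - A : selfAdjoint (H →L[ℂ] H)) : H →L[ℂ] H)‖ ≤ c := by
    refine norm_le_of_abs_quadForm_le _ (norm_nonneg _) fun z => ?_
    have h2 := abs_le.1 (abs_quadForm_le A z)
    have h3 := hA z
    rw [quadForm_sub, quadForm_smul, quadForm_one, abs_le]
    constructor <;> linarith
  rw [← hnorm, map_sub, map_smul, hone] at h1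
  have h2 := (abs_le.1 (abs_quadForm_le (c • 1 - φ A) x)).2.trans
    (mul_le_mul_of_nonneg_right h1 (sq_nonneg ‖x‖))
  rw [quadForm_sub, quadForm_smul, quadForm_one] at h2
  linarith

/-! ### Order characterization of rank one operators -/

theorem quadForm_rankOneSelf_nonneg (v x : H) : 0 ≤ quadForm (rankOneSelf v) x := by
  rw [quadForm_rankOneSelf]; positivity

theorem rankOneSelf_zero : rankOneSelf (0 : H) = 0 :=
  eq_of_quadForm_eq fun x => by rw [quadForm_rankOneSelf]; simp [quadForm]

theorem rankOneSelf_smul (c : ℂ) (x : H) : rankOneSelf (c • x) = (‖c‖ ^ 2) • rankOneSelf x :=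
  eq_of_quadForm_eq fun z => by
    rw [quadForm_smul, quadForm_rankOneSelf, quadForm_rankOneSelf, inner_smul_left, norm_mul,
      RCLike.norm_conj, mul_pow]

theorem rankOneSelf_smul_of_norm_eq_one {c : ℂ} (hc : ‖c‖ = 1) (x : H) :
    rankOneSelf (c • x) = rankOneSelf x :=
  eq_of_quadForm_eq fun z => by rw [rankOneSelf_smul, quadForm_smul, hc, one_pow, one_mul]

theorem exists_smul_of_rankOneSelf_eq {x y : H} (h : rankOneSelf x = rankOneSelf y) :
    ∃ c : ℂ, ‖c‖ = 1 ∧ x = c • y := by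
  have hn : ‖x‖ = ‖y‖ := by
    have := norm_rankOneSelf x
    rw [h, norm_rankOneSelf] at this
    exact ((pow_left_inj₀ (norm_nonneg _) (norm_nonneg _) two_ne_zero).1 this).symm
  by_cases hy : y = 0
  · refine ⟨1, norm_one, ?_⟩
    rw [hy, norm_zero, norm_eq_zero] at hn
    simp [hn, hy]
  have hx : x ≠ 0 := by rwa [← norm_ne_zero_iff, hn, norm_ne_zero_iff]
  have h1 : (rankOneSelf x : H →L[ℂ] H) x = (rankOneSelf y : H →L[ℂ] H) x := by rw [h]
  rw [rankOneSelf_apply, rankOneSelf_apply] at h1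
  have hxx : ⟪x, x⟫_ℂ ≠ 0 := by simpa using hx
  have h2 : x = ((⟪x, x⟫_ℂ)⁻¹ * ⟪y, x⟫_ℂ) • y := by
    rw [mul_smul, ← h1, smul_smul, inv_mul_cancel₀ hxx, one_smul]
  refine ⟨_, ?_, h2⟩
  have h3 := congrArg norm h2
  rw [norm_smul, hn] at h3
  exact (mul_eq_right₀ (norm_ne_zero_iff.2 hy)).1 h3.symm

/-- By Cauchy–Schwarz `B` kills the orthogonal complement of `v`, so its form depends only on the
component along `v`. -/
theorem eq_smul_rankOneSelf_of_le {B : selfAdjoint (H →L[ℂ] H)} {v : H}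
    (hB : ∀ x, 0 ≤ quadForm B x) (hv : ∀ x, quadForm B x ≤ quadForm (rankOneSelf v) x) :
    ∃ t : ℝ, B = t • rankOneSelf v := by
  by_cases hv0 : v = 0
  · refine ⟨0, eq_of_quadForm_eq fun x => ?_⟩
    have h1 := hv x
    rw [hv0, rankOneSelf_zero] at h1
    rw [zero_smul ℝ (rankOneSelf v)]
    have h2 : quadForm (0 : selfAdjoint (H →L[ℂ] H)) x = 0 := by simp [quadForm]
    exact le_antisymm h1 (h2 ▸ hB x)
  have hker : ∀ w, ⟪v, w⟫_ℂ = 0 → (B : H →L[ℂ] H) w = 0 := by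
    intro w hw
    have h1 := hv w
    rw [quadForm_rankOneSelf, hw, norm_zero, zero_pow two_ne_zero] at h1
    have h2 := norm_inner_sq_le_quadForm_mul hB w ((B : H →L[ℂ] H) w)
    rw [le_antisymm h1 (hB w), zero_mul] at h2
    have h3 : ‖⟪(B : H →L[ℂ] H) w, (B : H →L[ℂ] H) w⟫_ℂ‖ = 0 := by
      simpa using le_antisymm h2 (sq_nonneg _)
    simpa using h3
  have hvv : ⟪v, v⟫_ℂ ≠ 0 := by simpa using hv0
  have hvn : ‖v‖ ≠ 0 := norm_ne_zero_iff.2 hv0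
  -- The factor is found by evaluating at `v`, where the form of `rankOneSelf v` is `‖v‖ ^ 4`.
  refine ⟨quadForm B v / ‖v‖ ^ 4, eq_of_quadForm_eq fun x => ?_⟩
  set a := (⟪v, v⟫_ℂ)⁻¹ * ⟪v, x⟫_ℂ with ha
  have hw : (B : H →L[ℂ] H) (x - a • v) = 0 := hker _ (by
    rw [inner_sub_right, inner_smul_right, ha]
    field_simp
    simp)
  have hx : quadForm B x = quadForm B (a • v) := by
    conv_lhs => rw [← sub_add_cancel x (a • v)]
    rw [quadForm_apply_add, hw, quadForm, hw]
    simp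
  have hna : ‖a‖ = ‖⟪v, x⟫_ℂ‖ / ‖v‖ ^ 2 := by
    rw [ha, norm_mul, norm_inv, inner_self_eq_norm_sq_to_K, norm_pow, RCLike.norm_ofReal,
      abs_of_nonneg (norm_nonneg _), inv_mul_eq_div]
  rw [hx, quadForm_apply_smul, quadForm_smul, quadForm_rankOneSelf, hna]
  field_simp

/-- For `v = A x ≠ 0`, Cauchy–Schwarz says that `rankOneSelf v` lies below `⟪A x, x⟫ A`; minimality
of `A` then makes the two proportional. -/
theorem exists_eq_rankOneSelf {A : selfAdjoint (H →L[ℂ] H)} (hA : ∀ x, 0 ≤ quadForm A x)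
    (h : ∀ B : selfAdjoint (H →L[ℂ] H), (∀ x, 0 ≤ quadForm B x) →
      (∀ x, quadForm B x ≤ quadForm A x) → ∃ t : ℝ, B = t • A) :
    ∃ v, A = rankOneSelf v := by
  by_cases hA0 : ∀ x, (A : H →L[ℂ] H) x = 0
  · exact ⟨0, eq_of_quadForm_eq fun x => by
      rw [rankOneSelf_zero]; simp [quadForm, hA0]⟩
  push Not at hA0
  obtain ⟨x, hx⟩ := hA0
  set v := (A : H →L[ℂ] H) x with hv
  have hcs : ∀ y, quadForm (rankOneSelf v) y ≤ quadForm A x * quadForm A y := fun y => by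
    rw [quadForm_rankOneSelf]
    exact norm_inner_sq_le_quadForm_mul hA x y
  have hvpos : 0 < quadForm (rankOneSelf v) v := by
    rw [quadForm_rankOneSelf]
    have : ⟪v, v⟫_ℂ ≠ 0 := by simpa using hx
    positivity
  have hq : 0 < quadForm A x := by
    refine lt_of_le_of_ne (hA x) fun h0 => ?_
    have := hcs v
    rw [← h0, zero_mul] at this
    linarith
  obtain ⟨t, ht⟩ := h ((quadForm A x)⁻¹ • rankOneSelf v)
    (fun y => by
      rw [quadForm_smul]
      exact mul_nonneg (inv_nonneg.2 hq.le) (quadForm_rankOneSelf_nonneg v y))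
    (fun y => by
      rw [quadForm_smul, inv_mul_le_iff₀ hq]
      exact hcs y)
  have htv : (quadForm A x)⁻¹ * quadForm (rankOneSelf v) v = t * quadForm A v := by
    rw [← quadForm_smul, ht, quadForm_smul]
  have htpos : 0 < t := by
    have h1 : 0 < t * quadForm A v := htv ▸ mul_pos (inv_pos.2 hq) hvpos
    exact pos_of_mul_pos_left h1 (hA v)
  refine ⟨((Real.sqrt ((t * quadForm A x)⁻¹) : ℝ) : ℂ) • v, ?_⟩
  refine eq_of_quadForm_eq fun y => ?_
  have hy : (quadForm A x)⁻¹ * quadForm (rankOneSelf v) y = t * quadForm A y := by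
    rw [← quadForm_smul, ht, quadForm_smul]
  rw [rankOneSelf_smul, Complex.norm_real, Real.norm_eq_abs, sq_abs, Real.sq_sqrt (by positivity),
    mul_inv, quadForm_smul, mul_assoc, hy, inv_mul_cancel_left₀ htpos.ne']

/-- A unital linear order isomorphism of the self-adjoint operators. -/
structure IsUnitalOrderIso (φ : selfAdjoint (H →L[ℂ] H) ≃ₗ[ℝ] selfAdjoint (H →L[ℂ] H)) :
    Prop where
  map_one : φ 1 = 1
  nonneg : ∀ A, (∀ x, 0 ≤ quadForm A x) → ∀ x, 0 ≤ quadForm (φ A) x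
  symm_nonneg : ∀ A, (∀ x, 0 ≤ quadForm A x) → ∀ x, 0 ≤ quadForm (φ.symm A) x

/-! ### Unital order isomorphisms preserve rays and quadratic forms -/

namespace IsUnitalOrderIso

variable {φ : selfAdjoint (H →L[ℂ] H) ≃ₗ[ℝ] selfAdjoint (H →L[ℂ] H)}

theorem symm (hφ : IsUnitalOrderIso φ) : IsUnitalOrderIso φ.symm where
  map_one := by rw [LinearEquiv.symm_apply_eq, hφ.map_one]
  nonneg := hφ.symm_nonneg
  symm_nonneg := hφ.nonneg

theorem mono (hφ : IsUnitalOrderIso φ) {A B : selfAdjoint (H →L[ℂ] H)}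
    (h : ∀ x, quadForm A x ≤ quadForm B x) (x : H) : quadForm (φ A) x ≤ quadForm (φ B) x := by
  have := hφ.nonneg (B - A) (fun x => by rw [quadForm_sub]; linarith [h x]) x
  rw [map_sub, quadForm_sub] at this
  linarith

theorem exists_map_rankOneSelf (hφ : IsUnitalOrderIso φ) (x : H) :
    ∃ y, φ (rankOneSelf x) = rankOneSelf y := by
  refine exists_eq_rankOneSelf (hφ.nonneg _ (quadForm_rankOneSelf_nonneg x)) fun B hB hle => ?_
  have hle' := hφ.symm.mono hle
  rw [LinearEquiv.symm_apply_apply] at hle'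
  obtain ⟨t, ht⟩ := eq_smul_rankOneSelf_of_le (hφ.symm_nonneg B hB) hle'
  refine ⟨t, ?_⟩
  rw [← map_smul, ← ht, LinearEquiv.apply_symm_apply]

/-- For a unit vector `x`, `⟪A x, x⟫` is the infimum of the `c` such that `A + t • rankOneSelf x ≤
(c + t) • 1` for some `t`. Such an inequality survives `φ` and is then evaluated at `y`. -/
theorem quadForm_map_le (hφ : IsUnitalOrderIso φ) {x y : H} (hx : ‖x‖ = 1) (hy : ‖y‖ = 1)
    (hxy : φ (rankOneSelf x) = rankOneSelf y) (A : selfAdjoint (H →L[ℂ] H)) :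
    quadForm (φ A) y ≤ quadForm A x := by
  refine le_of_forall_gt_imp_ge_of_dense fun c hc => ?_
  obtain ⟨t, -, ht⟩ := exists_quadForm_add_le hx hc
  have h := hφ.mono (A := A + t • rankOneSelf x) (B := (c + t) • 1) (fun z => by
    rw [quadForm_add, quadForm_smul, quadForm_rankOneSelf, quadForm_smul, quadForm_one]
    exact ht z) y
  rw [map_add, map_smul, map_smul, hφ.map_one, hxy, quadForm_add, quadForm_smul, quadForm_smul,
    quadForm_one, quadForm_rankOneSelf, inner_self_eq_norm_sq_to_K, hy] at h
  simp at h
  exact h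

theorem quadForm_map_eq_of_norm_eq_one (hφ : IsUnitalOrderIso φ) {x y : H} (hx : ‖x‖ = 1)
    (hy : ‖y‖ = 1) (hxy : φ (rankOneSelf x) = rankOneSelf y) (A : selfAdjoint (H →L[ℂ] H)) :
    quadForm (φ A) y = quadForm A x := by
  refine le_antisymm (hφ.quadForm_map_le hx hy hxy A) ?_
  have := hφ.quadForm_map_le hx hy hxy (-A)
  rw [map_neg, quadForm_neg, quadForm_neg] at this
  linarith

/-- The least `c ≥ 0` with `rankOneSelf x ≤ c • 1` is `‖x‖ ^ 2`, which `φ` and its inverse both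
respect. -/
theorem norm_eq_of_map_rankOneSelf (hφ : IsUnitalOrderIso φ) {x y : H}
    (hxy : φ (rankOneSelf x) = rankOneSelf y) : ‖y‖ = ‖x‖ := by
  have key : ∀ {ψ : selfAdjoint (H →L[ℂ] H) ≃ₗ[ℝ] selfAdjoint (H →L[ℂ] H)},
      IsUnitalOrderIso ψ → ∀ {x y : H}, ψ (rankOneSelf x) = rankOneSelf y → ‖y‖ ≤ ‖x‖ := by
    intro ψ hψ x y h
    have h1 : ‖(rankOneSelf y : H →L[ℂ] H)‖ ≤ ‖x‖ ^ 2 :=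
      norm_le_of_abs_quadForm_le _ (sq_nonneg _) fun z => by
        have h2 := hψ.mono (A := rankOneSelf x) (B := (‖x‖ ^ 2) • 1) (fun z => by
          have := abs_quadForm_le (rankOneSelf x) z
          rw [norm_rankOneSelf] at this
          rw [quadForm_smul, quadForm_one]
          exact (le_abs_self _).trans this) z
        rw [map_smul, hψ.map_one, quadForm_smul, quadForm_one, h] at h2
        rwa [abs_of_nonneg (quadForm_rankOneSelf_nonneg y z)]
    rw [norm_rankOneSelf] at h1
    exact (pow_le_pow_iff_left₀ (norm_nonneg _) (norm_nonneg _) two_ne_zero).1 h1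
  exact le_antisymm (key hφ hxy) (key hφ.symm (by rw [← hxy, LinearEquiv.symm_apply_apply]))

theorem quadForm_map_eq (hφ : IsUnitalOrderIso φ) {x y : H}
    (hxy : φ (rankOneSelf x) = rankOneSelf y) (A : selfAdjoint (H →L[ℂ] H)) :
    quadForm (φ A) y = quadForm A x := by
  have hn := hφ.norm_eq_of_map_rankOneSelf hxy
  by_cases hx : x = 0
  · rw [hx, norm_zero, norm_eq_zero] at hn
    simp [hx, hn, quadForm]
  have hx' : ‖x‖ ≠ 0 := norm_ne_zero_iff.2 hx
  have hc : ‖((‖x‖⁻¹ : ℝ) : ℂ)‖ = ‖x‖⁻¹ := by simp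
  have h := hφ.quadForm_map_eq_of_norm_eq_one (x := ((‖x‖⁻¹ : ℝ) : ℂ) • x)
    (y := ((‖x‖⁻¹ : ℝ) : ℂ) • y) (by rw [norm_smul, hc, inv_mul_cancel₀ hx'])
    (by rw [norm_smul, hc, hn, inv_mul_cancel₀ hx'])
    (by rw [rankOneSelf_smul, rankOneSelf_smul, map_smul, hxy]) A
  rw [quadForm_apply_smul, quadForm_apply_smul, hc] at h
  exact mul_left_cancel₀ (by positivity) h

/-- Preservation of transition probabilities, the hypothesis of Wigner's theorem. -/
theorem norm_inner_eq_of_map_rankOneSelf (hφ : IsUnitalOrderIso φ) {x y x' y' : H}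
    (hx : φ (rankOneSelf x) = rankOneSelf x') (hy : φ (rankOneSelf y) = rankOneSelf y') :
    ‖⟪x', y'⟫_ℂ‖ = ‖⟪x, y⟫_ℂ‖ := by
  have h := hφ.quadForm_map_eq hy (rankOneSelf x)
  rw [hx, quadForm_rankOneSelf, quadForm_rankOneSelf] at h
  exact (pow_left_inj₀ (norm_nonneg _) (norm_nonneg _) two_ne_zero).1 h

end IsUnitalOrderIso

end SelfAdjointIsometry

/-! ### Wigner's construction of the implementing operator -/

section WignerConstruction

set_option synthInstance.maxHeartbeats 200000

variable {H : Type*} [NormedAddCommGroup H] [InnerProductSpace ℂ H] [CompleteSpace H]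

/-- The symmetric operator `z ↦ ⟪x, z⟫ y + ⟪y, z⟫ x`, as the polarization of `rankOneSelf`. -/
noncomputable def symRankOne (x y : H) : selfAdjoint (H →L[ℂ] H) :=
  rankOneSelf (x + y) - rankOneSelf x - rankOneSelf y

theorem symRankOne_apply (x y z : H) :
    (symRankOne x y : H →L[ℂ] H) z = ⟪x, z⟫_ℂ • y + ⟪y, z⟫_ℂ • x := by
  have h : (symRankOne x y : H →L[ℂ] H) z = (rankOneSelf (x + y) : H →L[ℂ] H) z -
    (rankOneSelf x : H →L[ℂ] H) z - (rankOneSelf y : H →L[ℂ] H) z := rfl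
  rw [h]
  simp only [rankOneSelf_apply, inner_add_left, smul_add, add_smul]
  abel

theorem symRankOne_add_right (x y z : H) :
    symRankOne x (y + z) = symRankOne x y + symRankOne x z := by
  ext w
  simp only [AddSubgroup.coe_add, add_apply, symRankOne_apply, inner_add_left, smul_add, add_smul]
  abel

theorem symRankOne_smul_right (x y : H) (t : ℝ) :
    symRankOne x ((t : ℂ) • y) = t • symRankOne x y := by
  ext w
  rw [coe_real_smul_apply]
  simp only [symRankOne_apply, inner_smul_left, smul_add, smul_smul, Complex.conj_ofReal]
  rw [mul_comm]

theorem rankOneSelf_real_smul_add (x y : H) (t : ℝ) :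
    rankOneSelf ((t : ℂ) • x + y) =
      (t ^ 2) • rankOneSelf x + t • symRankOne x y + rankOneSelf y := by
  ext w
  simp only [AddSubgroup.coe_add, add_apply, coe_real_smul_apply, symRankOne_apply,
    rankOneSelf_apply, inner_add_left, inner_smul_left, smul_add, add_smul, smul_smul,
    Complex.conj_ofReal]
  push_cast
  module

theorem rankOneSelf_add_add_rankOneSelf_sub (x y : H) :
    rankOneSelf (x + y) + rankOneSelf (x + -y) =
      (2 : ℝ) • rankOneSelf x + (2 : ℝ) • rankOneSelf y := by
  ext w
  simp only [AddSubgroup.coe_add, add_apply, coe_real_smul_apply, rankOneSelf_apply,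
    inner_add_left, inner_neg_left, smul_add, add_smul, smul_neg, neg_smul]
  push_cast
  simp only [two_smul]
  abel

namespace IsUnitalOrderIso

variable {φ : selfAdjoint (H →L[ℂ] H) ≃ₗ[ℝ] selfAdjoint (H →L[ℂ] H)} {e e' : H}

theorem exists_map_rankOneSelf_add (hφ : IsUnitalOrderIso φ) (he : ‖e‖ = 1)
    (hee : φ (rankOneSelf e) = rankOneSelf e') {x : H} (hx : ⟪e, x⟫_ℂ = 0) :
    ∃ w, ⟪e', w⟫_ℂ = 0 ∧ φ (rankOneSelf (e + x)) = rankOneSelf (e' + w) := by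
  have he' : ‖e'‖ = 1 := (hφ.norm_eq_of_map_rankOneSelf hee).trans he
  obtain ⟨h, hh⟩ := hφ.exists_map_rankOneSelf (e + x)
  have h1 := hφ.norm_inner_eq_of_map_rankOneSelf hee hh
  rw [inner_add_right, hx, add_zero, inner_self_eq_norm_sq_to_K, he] at h1
  replace h1 : ‖⟪e', h⟫_ℂ‖ = 1 := by simpa using h1
  have h0 : ⟪e', h⟫_ℂ ≠ 0 := by rw [← norm_ne_zero_iff, h1]; exact one_ne_zero
  -- The vector `h` is determined only up to a phase, which is chosen so that its component along
  -- `e'` is exactly `e'`.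
  refine ⟨(⟪e', h⟫_ℂ)⁻¹ • h - e', ?_, ?_⟩
  · rw [inner_sub_right, inner_smul_right, inv_mul_cancel₀ h0, inner_self_eq_norm_sq_to_K, he']
    simp
  · rw [add_sub_cancel, rankOneSelf_smul_of_norm_eq_one (by rw [norm_inv, h1, inv_one]), hh]

/-- Let `e + x` and `e - x` correspond to `e' + w` and `e' + v`. The parallelogram identity for rank
one operators, evaluated at `e'`, forces `v = -w`; the same identity then identifies the image of
`rankOneSelf x`. -/
theorem exists_map_symRankOne (hφ : IsUnitalOrderIso φ) (he : ‖e‖ = 1)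
    (hee : φ (rankOneSelf e) = rankOneSelf e') {x : H} (hx : ⟪e, x⟫_ℂ = 0) :
    ∃ w, ⟪e', w⟫_ℂ = 0 ∧ φ (rankOneSelf x) = rankOneSelf w ∧
      φ (symRankOne e x) = symRankOne e' w := by
  have he' : ‖e'‖ = 1 := (hφ.norm_eq_of_map_rankOneSelf hee).trans he
  have hee1 : ⟪e', e'⟫_ℂ = 1 := by simp [inner_self_eq_norm_sq_to_K, he']
  obtain ⟨w, hw, hw1⟩ := hφ.exists_map_rankOneSelf_add he hee hx
  obtain ⟨v, hv, hv1⟩ := hφ.exists_map_rankOneSelf_add he hee (x := -x) (by simp [hx])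
  obtain ⟨g, hg⟩ := hφ.exists_map_rankOneSelf x
  have hge : ⟪g, e'⟫_ℂ = 0 := by
    have := hφ.norm_inner_eq_of_map_rankOneSelf hee hg
    rw [hx, norm_zero, norm_eq_zero] at this
    exact inner_eq_zero_symm.1 this
  have hwe : ⟪w, e'⟫_ℂ = 0 := inner_eq_zero_symm.1 hw
  have hve : ⟪v, e'⟫_ℂ = 0 := inner_eq_zero_symm.1 hv
  have hsum := congrArg φ (rankOneSelf_add_add_rankOneSelf_sub e x)
  rw [map_add, map_add, map_smul, map_smul, hw1, hv1, hee, hg] at hsum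
  have hvw : v = -w := by
    have h1 := congrArg (fun A : selfAdjoint (H →L[ℂ] H) => (A : H →L[ℂ] H) e') hsum
    simp only [AddSubgroup.coe_add, add_apply, coe_real_smul_apply, rankOneSelf_apply,
      inner_add_left, hee1, hwe, hve, hge, add_zero, one_smul, zero_smul, smul_zero] at h1
    push_cast at h1
    rw [two_smul] at h1
    have h2 : w + v = 0 := by
      have h3 : w + v = (e' + w + (e' + v)) - (e' + e') := by abel
      rw [h3, h1, sub_self]
    exact eq_neg_of_add_eq_zero_right h2
  have hgw : rankOneSelf g = rankOneSelf w := by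
    rw [hvw, rankOneSelf_add_add_rankOneSelf_sub] at hsum
    refine eq_of_quadForm_eq fun z => ?_
    have := congrArg (fun A => quadForm A z) hsum
    simp only [quadForm_add, quadForm_smul] at this
    linarith
  refine ⟨w, hw, hg.trans hgw, ?_⟩
  rw [symRankOne, map_sub, map_sub, hw1, hee, hg, hgw, symRankOne]

/-- The real-linear map whose restriction to `e^⊥` implements `φ` there. -/
noncomputable def orthMap (φ : selfAdjoint (H →L[ℂ] H) ≃ₗ[ℝ] selfAdjoint (H →L[ℂ] H))
    (e e' : H) : H →ₗ[ℝ] H where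
  toFun x := (φ (symRankOne e x) : H →L[ℂ] H) e'
  map_add' x y := by
    rw [symRankOne_add_right, map_add]
    rfl
  map_smul' t x := by
    rw [← Complex.coe_smul, symRankOne_smul_right, map_smul, coe_real_smul_apply, Complex.coe_smul]
    rfl

/-- Evaluating `symRankOne e' w` at `e'` returns `w`, so the vector known only to exist is given by
a real-linear formula. -/
theorem orthMap_spec (hφ : IsUnitalOrderIso φ) (he : ‖e‖ = 1)
    (hee : φ (rankOneSelf e) = rankOneSelf e') {x : H} (hx : ⟪e, x⟫_ℂ = 0) :
    φ (rankOneSelf x) = rankOneSelf (orthMap φ e e' x) ∧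
      φ (symRankOne e x) = symRankOne e' (orthMap φ e e' x) := by
  have he' : ‖e'‖ = 1 := (hφ.norm_eq_of_map_rankOneSelf hee).trans he
  obtain ⟨w, hw, h1, h2⟩ := hφ.exists_map_symRankOne he hee hx
  have h3 : orthMap φ e e' x = w := by
    change (φ (symRankOne e x) : H →L[ℂ] H) e' = w
    rw [h2, symRankOne_apply, inner_eq_zero_symm.1 hw, inner_self_eq_norm_sq_to_K, he']
    simp
  rw [h3]
  exact ⟨h1, h2⟩

/-- The vectors `x` and `i x` have the same rank one operator, so their images differ by a phase
`c`. Isometry on `x + i x` gives `|1 + c| = |1 + i|`, whence `c = ±i`. -/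
theorem orthMap_I_smul (hφ : IsUnitalOrderIso φ) (he : ‖e‖ = 1)
    (hee : φ (rankOneSelf e) = rankOneSelf e') {x : H} (hx : ⟪e, x⟫_ℂ = 0) :
    orthMap φ e e' (Complex.I • x) = Complex.I • orthMap φ e e' x ∨
      orthMap φ e e' (Complex.I • x) = -(Complex.I • orthMap φ e e' x) := by
  set W := orthMap φ e e' with hW
  by_cases hx0 : x = 0
  · simp [hx0]
  have hIx : ⟪e, Complex.I • x⟫_ℂ = 0 := by rw [inner_smul_right, hx, mul_zero]
  have hn : ∀ {y : H}, ⟪e, y⟫_ℂ = 0 → ‖W y‖ = ‖y‖ := fun hy =>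
    hφ.norm_eq_of_map_rankOneSelf (hφ.orthMap_spec he hee hy).1
  obtain ⟨c, hc, hWc⟩ := exists_smul_of_rankOneSelf_eq (x := W (Complex.I • x)) (y := W x) (by
    rw [hW, ← (hφ.orthMap_spec he hee hIx).1, ← (hφ.orthMap_spec he hee hx).1,
      rankOneSelf_smul_of_norm_eq_one Complex.norm_I])
  have h1 : ‖W (x + Complex.I • x)‖ = ‖x + Complex.I • x‖ :=
    hn (by rw [inner_add_right, hx, hIx, add_zero])
  rw [map_add, hWc] at h1
  have h2 : W x + c • W x = (1 + c) • W x := by rw [add_smul, one_smul]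
  have h3 : x + Complex.I • x = (1 + Complex.I) • x := by rw [add_smul, one_smul]
  rw [h2, h3, norm_smul, norm_smul, hn hx] at h1
  have h4 : ‖1 + c‖ = ‖1 + Complex.I‖ := mul_right_cancel₀ (norm_ne_zero_iff.2 hx0) h1
  have h5 : Complex.normSq (1 + c) = 2 := by
    rw [Complex.normSq_eq_norm_sq, h4, ← Complex.normSq_eq_norm_sq]
    norm_num [Complex.normSq_apply]
  have h6 : Complex.normSq c = 1 := by rw [Complex.normSq_eq_norm_sq, hc, one_pow]
  simp only [Complex.normSq_apply, Complex.add_re, Complex.add_im, Complex.one_re,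
    Complex.one_im] at h5 h6
  have hre : c.re = 0 := by linarith
  have him : (c.im - 1) * (c.im + 1) = 0 := by rw [hre] at h6; linarith
  rw [hWc]
  rcases mul_eq_zero.1 him with h | h
  · left
    congr 1
    apply Complex.ext <;> simp [hre, sub_eq_zero.1 h]
  · right
    rw [← neg_smul]
    congr 1
    apply Complex.ext <;> simp [hre, eq_neg_of_add_eq_zero_left h]

theorem orthMap_smul (hφ : IsUnitalOrderIso φ) (he : ‖e‖ = 1)
    (hee : φ (rankOneSelf e) = rankOneSelf e') :
    ∃ σ : ℂ →+* ℂ, (σ = RingHom.id ℂ ∨ σ = starRingEnd ℂ) ∧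
      ∀ (c : ℂ) (x : H), ⟪e, x⟫_ℂ = 0 → orthMap φ e e' (c • x) = σ c • orthMap φ e e' x := by
  set W := orthMap φ e e' with hW
  have hsplit : ∀ (c : ℂ) (x : H),
      W (c • x) = (c.re : ℂ) • W x + (c.im : ℂ) • W (Complex.I • x) := by
    intro c x
    rw [Complex.coe_smul, Complex.coe_smul, ← map_smul, ← map_smul, ← map_add,
      ← Complex.coe_smul, ← Complex.coe_smul, smul_smul, ← add_smul, Complex.re_add_im]
  let K : Submodule ℂ H := LinearMap.ker (innerSL ℂ e : H →ₗ[ℂ] ℂ)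
  let WI : H →+ H := W.toAddMonoidHom.comp (DistribSMul.toAddMonoidHom H Complex.I)
  let IW : H →+ H := (DistribSMul.toAddMonoidHom H Complex.I).comp W.toAddMonoidHom
  have hK : ∀ x : K, ⟪e, (x : H)⟫_ℂ = 0 := fun x => x.2
  -- The sign could depend on `x`; additivity on the orthogonal complement of `e` makes it uniform.
  rcases forall_or_forall_of_forall_or ((WI - IW).comp K.subtype.toAddMonoidHom)
    ((WI + IW).comp K.subtype.toAddMonoidHom) (fun x => by
      rcases hφ.orthMap_I_smul he hee (hK x) with h | h
      · left
        exact sub_eq_zero.2 h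
      · right
        exact eq_neg_iff_add_eq_zero.1 h) with h | h
  · refine ⟨RingHom.id ℂ, .inl rfl, fun c x hx => ?_⟩
    have h1 : W (Complex.I • x) = Complex.I • W x := sub_eq_zero.1 (h ⟨x, hx⟩)
    rw [hsplit, h1, smul_smul, ← add_smul, Complex.re_add_im, RingHom.id_apply]
  · refine ⟨starRingEnd ℂ, .inr rfl, fun c x hx => ?_⟩
    have h1 : W (Complex.I • x) = -(Complex.I • W x) := eq_neg_iff_add_eq_zero.2 (h ⟨x, hx⟩)
    rw [hsplit, h1, smul_neg, smul_smul, ← neg_smul, ← add_smul]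
    congr 1
    apply Complex.ext <;> simp

/-- The (semi)linear extension of `orthMap` to the whole space sending `e` to `e'`. -/
noncomputable def wignerMap (φ : selfAdjoint (H →L[ℂ] H) ≃ₗ[ℝ] selfAdjoint (H →L[ℂ] H))
    (σ : ℂ → ℂ) (e e' z : H) : H :=
  σ ⟪e, z⟫_ℂ • e' + orthMap φ e e' (z - ⟪e, z⟫_ℂ • e)

theorem exists_semilinear_isometry [Nontrivial H] (hφ : IsUnitalOrderIso φ) :
    ∃ σ : ℂ →+* ℂ, (σ = RingHom.id ℂ ∨ σ = starRingEnd ℂ) ∧ ∃ U : H →ₛₗ[σ] H,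
      (∀ x, ‖U x‖ = ‖x‖) ∧ Function.Surjective U ∧
      ∀ A x, quadForm (φ A) (U x) = quadForm A x := by
  obtain ⟨e, he⟩ := exists_norm_eq H zero_le_one
  obtain ⟨e', hee⟩ := hφ.exists_map_rankOneSelf e
  obtain ⟨σ, hσ, hW⟩ := hφ.orthMap_smul he hee
  have hσσ : ∀ c, σ (σ c) = c := by rcases hσ with rfl | rfl <;> simp
  have hσn : ∀ c, ‖σ c‖ = ‖c‖ := by rcases hσ with rfl | rfl <;> simp
  have hσr : ∀ t : ℝ, σ t = t := by rcases hσ with rfl | rfl <;> simp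
  have he1 : ⟪e, e⟫_ℂ = 1 := by simp [inner_self_eq_norm_sq_to_K, he]
  have horth : ∀ z, ⟪e, z - ⟪e, z⟫_ℂ • e⟫_ℂ = 0 := fun z => by
    rw [inner_sub_right, inner_smul_right, he1, mul_one, sub_self]
  let U : H →ₛₗ[σ] H :=
    { toFun := wignerMap φ σ e e'
      map_add' := fun x y => by
        have : x + y - ⟪e, x + y⟫_ℂ • e = (x - ⟪e, x⟫_ℂ • e) + (y - ⟪e, y⟫_ℂ • e) := by
          rw [inner_add_right, add_smul]; abel
        rw [wignerMap, this, map_add, inner_add_right, map_add, add_smul, wignerMap, wignerMap]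
        abel
      map_smul' := fun c x => by
        have : c • x - ⟪e, c • x⟫_ℂ • e = c • (x - ⟪e, x⟫_ℂ • e) := by
          rw [inner_smul_right, smul_sub, smul_smul]
        rw [wignerMap, this, hW c _ (horth x), inner_smul_right, map_mul, mul_smul, ← smul_add,
          wignerMap] }
  have hU : ∀ (a : ℂ) (x : H), ⟪e, x⟫_ℂ = 0 → U (a • e + x) = σ a • e' + orthMap φ e e' x := by
    intro a x hx
    change wignerMap φ σ e e' (a • e + x) = _
    rw [wignerMap, inner_add_right, inner_smul_right, he1, hx, mul_one, add_zero,
      add_sub_cancel_left]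
  -- For a real coefficient of `e`, the rank one operator is a real combination of operators whose
  -- images are already known.
  have hreal : ∀ (t : ℝ) (x : H), ⟪e, x⟫_ℂ = 0 →
      φ (rankOneSelf ((t : ℂ) • e + x)) = rankOneSelf (U ((t : ℂ) • e + x)) := by
    intro t x hx
    rw [hU _ x hx, hσr, rankOneSelf_real_smul_add, rankOneSelf_real_smul_add, map_add, map_add,
      map_smul, map_smul, hee, ← (hφ.orthMap_spec he hee hx).1, (hφ.orthMap_spec he hee hx).2]
  have hrank : ∀ z, φ (rankOneSelf z) = rankOneSelf (U z) := by
    intro z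
    set a := ⟪e, z⟫_ℂ with ha
    have hz : z = a • e + (z - a • e) := by abel
    by_cases ha0 : a = 0
    · have := hreal 0 z ha0
      simpa using this
    -- Multiplication by the conjugate of `a` makes the `e`-component real and changes the rank one
    -- operator only by the factor `‖a‖ ^ 2`.
    have hc : (starRingEnd ℂ) a • z =
        ((‖a‖ ^ 2 : ℝ) : ℂ) • e + (starRingEnd ℂ) a • (z - a • e) := by
      conv_lhs => rw [hz]
      rw [smul_add, smul_smul, Complex.conj_mul', Complex.ofReal_pow]
    have h1 := hreal (‖a‖ ^ 2) ((starRingEnd ℂ) a • (z - a • e)) (by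
      rw [inner_smul_right, horth, mul_zero])
    rw [← hc, map_smulₛₗ, rankOneSelf_smul, rankOneSelf_smul, hσn, RCLike.norm_conj,
      map_smul] at h1
    refine eq_of_quadForm_eq fun y => ?_
    have h2 := congrArg (fun A => quadForm A y) h1
    simp only [quadForm_smul] at h2
    exact mul_left_cancel₀ (pow_ne_zero 2 (norm_ne_zero_iff.2 ha0)) h2
  refine ⟨σ, hσ, U, fun x => hφ.norm_eq_of_map_rankOneSelf (hrank x), fun v => ?_,
    fun A x => hφ.quadForm_map_eq (hrank x) A⟩
  -- Surjectivity: pulling back `rankOneSelf v` gives a `z` with `U z` equal to `v` up to a phase,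
  -- which `σ`, an involution, moves inside `U`.
  obtain ⟨z, hz⟩ := hφ.symm.exists_map_rankOneSelf v
  have h1 : rankOneSelf v = rankOneSelf (U z) := by
    rw [← hrank, ← hz, LinearEquiv.apply_symm_apply]
  obtain ⟨c, -, hc⟩ := exists_smul_of_rankOneSelf_eq h1
  exact ⟨σ c • z, by rw [map_smulₛₗ, hσσ, hc]⟩

end IsUnitalOrderIso

/-! ### Unitary and antiunitary implementation -/

/-- Polarization preserves real parts; replacing `y` by `i y` reverses the sign of the imaginary
part. -/
theorem inner_map_map_of_conjLinear {H : Type*} [NormedAddCommGroup H] [InnerProductSpace ℂ H]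
    (U : H →ₗ⋆[ℂ] H) (hU : ∀ x, ‖U x‖ = ‖x‖) (x y : H) : ⟪U x, U y⟫_ℂ = ⟪y, x⟫_ℂ := by
  have hre : ∀ x y, (⟪U x, U y⟫_ℂ).re = (⟪x, y⟫_ℂ).re := by
    intro x y
    have h1 := @norm_add_sq ℂ _ _ _ _ (U x) (U y)
    have h2 := @norm_add_sq ℂ _ _ _ _ x y
    rw [← map_add, hU, hU, hU, h2] at h1
    simp only [RCLike.re_to_complex] at h1
    linarith
  apply Complex.ext
  · rw [hre, ← inner_conj_symm, Complex.conj_re]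
  · have := hre x (Complex.I • y)
    rw [map_smulₛₗ, inner_smul_right, inner_smul_right] at this
    rw [← inner_conj_symm y x, Complex.conj_im]
    simp at this
    linarith

theorem conjAdjoint_map_self (U : H →L⋆[ℂ] H) (hU : ∀ x, ‖U x‖ = ‖x‖) (x : H) :
    conjAdjoint U (U x) = x := by
  refine ext_inner_right ℂ fun y => ?_
  rw [inner_conjAdjoint_left]
  exact inner_map_map_of_conjLinear (U : H →ₗ⋆[ℂ] H) hU y x

namespace IsUnitalOrderIso

variable {φ : selfAdjoint (H →L[ℂ] H) ≃ₗ[ℝ] selfAdjoint (H →L[ℂ] H)}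

theorem exists_unitary_or_antiunitary (hφ : IsUnitalOrderIso φ) :
    (∃ U ∈ unitary (H →L[ℂ] H), ∀ A : selfAdjoint (H →L[ℂ] H),
      (φ A : H →L[ℂ] H) = U * (A : H →L[ℂ] H) * star U) ∨
    (∃ U : H →L⋆[ℂ] H, IsAntiunitary U ∧ ∀ A : selfAdjoint (H →L[ℂ] H),
      (φ A : H →L[ℂ] H) = U.comp ((A : H →L[ℂ] H).comp (conjAdjoint U))) := by
  rcases subsingleton_or_nontrivial H with hH | hH
  · exact .inl ⟨1, one_mem _, fun A => by ext x; exact Subsingleton.elim _ _⟩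
  obtain ⟨σ, hσ, U, hU, hsurj, hq⟩ := hφ.exists_semilinear_isometry
  rcases hσ with rfl | rfl
  · left
    let V : H ≃ₗᵢ[ℂ] H := LinearIsometryEquiv.ofSurjective ⟨U, hU⟩ hsurj
    let u := Unitary.linearIsometryEquiv.symm V
    have hu : ∀ x, (u : H →L[ℂ] H) x = U x := fun x => rfl
    refine ⟨u, u.2, fun A => ?_⟩
    have hs : ∀ x, star (u : H →L[ℂ] H) ((u : H →L[ℂ] H) x) = x := fun x => by
      have := (Unitary.mem_iff.1 u.2).1
      exact DFunLike.congr_fun this x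
    -- On a complex space the form `⟪T y, y⟫` determines `T`, and every `y` has the form `U x`.
    refine (ContinuousLinearMap.coe_inj.1 ((ext_inner_map _ _).1 fun y => ?_))
    obtain ⟨x, rfl⟩ := hsurj y
    have h1 : ⟪((φ A : H →L[ℂ] H) : H →ₗ[ℂ] H) (U x), U x⟫_ℂ = quadForm (φ A) (U x) :=
      (quadForm_eq_inner _ _).symm
    rw [h1, hq, quadForm_eq_inner, ← hu]
    change _ = ⟪(u : H →L[ℂ] H) ((A : H →L[ℂ] H) (star (u : H →L[ℂ] H) ((u : H →L[ℂ] H) x))),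
      (u : H →L[ℂ] H) x⟫_ℂ
    rw [hs]
    exact (V.inner_map_map _ _).symm
  · right
    let V : H →L⋆[ℂ] H := (⟨U, hU⟩ : H →ₛₗᵢ[starRingEnd ℂ] H).toContinuousLinearMap
    have hV : ∀ x, ‖V x‖ = ‖x‖ := hU
    have hinj : Function.Injective V := (⟨U, hU⟩ : H →ₛₗᵢ[starRingEnd ℂ] H).injective
    refine ⟨V, ⟨⟨hinj, hsurj⟩, hU⟩, fun A => ?_⟩
    refine (ContinuousLinearMap.coe_inj.1 ((ext_inner_map _ _).1 fun y => ?_))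
    obtain ⟨x, rfl⟩ := hsurj y
    have h1 : ⟪((φ A : H →L[ℂ] H) : H →ₗ[ℂ] H) (U x), U x⟫_ℂ = quadForm (φ A) (U x) :=
      (quadForm_eq_inner _ _).symm
    rw [h1, hq, quadForm_eq_inner]
    change _ = ⟪V ((A : H →L[ℂ] H) (conjAdjoint V (V x))), V x⟫_ℂ
    rw [conjAdjoint_map_self V hV]
    exact (inner_selfAdjoint_apply _ _ _).trans
      (inner_map_map_of_conjLinear U hU ((A : H →L[ℂ] H) x) x).symm

end IsUnitalOrderIso

theorem exists_unitary_or_antiunitary_of_map_one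
    {φ : selfAdjoint (H →L[ℂ] H) →ₗ[ℝ] selfAdjoint (H →L[ℂ] H)} (hbij : Function.Bijective φ)
    (hnorm : ∀ A : selfAdjoint (H →L[ℂ] H), ‖(φ A : H →L[ℂ] H)‖ = ‖(A : H →L[ℂ] H)‖)
    (hone : φ 1 = 1) :
    (∃ U ∈ unitary (H →L[ℂ] H), ∀ A : selfAdjoint (H →L[ℂ] H),
      (φ A : H →L[ℂ] H) = U * (A : H →L[ℂ] H) * star U) ∨
    (∃ U : H →L⋆[ℂ] H, IsAntiunitary U ∧ ∀ A : selfAdjoint (H →L[ℂ] H),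
      (φ A : H →L[ℂ] H) = U.comp ((A : H →L[ℂ] H).comp (conjAdjoint U))) := by
  let ψ := LinearEquiv.ofBijective φ hbij
  have hψ : ∀ A, ψ A = φ A := fun A => rfl
  have h : IsUnitalOrderIso ψ :=
    { map_one := hone
      nonneg := fun A hA => quadForm_map_nonneg hnorm hone hA
      -- The inverse is again a unital isometry, so it is positive for the same reason.
      symm_nonneg := fun A hA => quadForm_map_nonneg (φ := ψ.symm.toLinearMap)
        (fun B => by
          rw [← hnorm, LinearEquiv.coe_coe, ← hψ, LinearEquiv.apply_symm_apply])
        (by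
          rw [LinearEquiv.coe_coe, LinearEquiv.symm_apply_eq, hψ, hone]) hA }
  exact h.exists_unitary_or_antiunitary

theorem exists_unitary_or_antiunitary_of_map_one_eq_neg_one
    {φ : selfAdjoint (H →L[ℂ] H) →ₗ[ℝ] selfAdjoint (H →L[ℂ] H)} (hbij : Function.Bijective φ)
    (hnorm : ∀ A : selfAdjoint (H →L[ℂ] H), ‖(φ A : H →L[ℂ] H)‖ = ‖(A : H →L[ℂ] H)‖)
    (hone : φ 1 = -1) :
    (∃ U ∈ unitary (H →L[ℂ] H), ∀ A : selfAdjoint (H →L[ℂ] H),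
      (φ A : H →L[ℂ] H) = -(U * (A : H →L[ℂ] H) * star U)) ∨
    (∃ U : H →L⋆[ℂ] H, IsAntiunitary U ∧ ∀ A : selfAdjoint (H →L[ℂ] H),
      (φ A : H →L[ℂ] H) = -(U.comp ((A : H →L[ℂ] H).comp (conjAdjoint U)))) := by
  let ψ : selfAdjoint (H →L[ℂ] H) →ₗ[ℝ] selfAdjoint (H →L[ℂ] H) :=
    { toFun := fun A => -φ A
      map_add' := fun A B => by rw [map_add, neg_add]
      map_smul' := fun t A => by rw [map_smul, RingHom.id_apply, smul_neg] }
  have hneg : ∀ A, ψ A = -φ A := fun A => rfl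
  have hb : Function.Bijective ψ := (Equiv.neg _).bijective.comp hbij
  rcases exists_unitary_or_antiunitary_of_map_one (φ := ψ) hb
    (fun A => by rw [hneg, NegMemClass.coe_neg, norm_neg, hnorm])
    (by rw [hneg, hone, neg_neg]) with ⟨U, hU, h⟩ | ⟨U, hU, h⟩
  · refine .inl ⟨U, hU, fun A => ?_⟩
    rw [← h A, hneg, NegMemClass.coe_neg, neg_neg]
  · refine .inr ⟨U, hU, fun A => ?_⟩
    rw [← h A, hneg, NegMemClass.coe_neg, neg_neg]

end WignerConstruction

theorem theorem1 {H : Type*} [NormedAddCommGroup H] [InnerProductSpace ℂ H] [CompleteSpace H]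
    (φ : selfAdjoint (H →L[ℂ] H) →ₗ[ℝ] selfAdjoint (H →L[ℂ] H))
    (hbij : Function.Bijective φ)
    (hnorm : ∀ A : selfAdjoint (H →L[ℂ] H), ‖(φ A : H →L[ℂ] H)‖ = ‖(A : H →L[ℂ] H)‖) :
    (∃ U ∈ unitary (H →L[ℂ] H),
      (∀ A : selfAdjoint (H →L[ℂ] H), (φ A : H →L[ℂ] H) = U * (A : H →L[ℂ] H) * star U) ∨
      (∀ A : selfAdjoint (H →L[ℂ] H), (φ A : H →L[ℂ] H) = -(U * (A : H →L[ℂ] H) * star U))) ∨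
    (∃ U : H →L⋆[ℂ] H, IsAntiunitary U ∧
      ((∀ A : selfAdjoint (H →L[ℂ] H),
          (φ A : H →L[ℂ] H) = U.comp ((A : H →L[ℂ] H).comp (conjAdjoint U))) ∨
       (∀ A : selfAdjoint (H →L[ℂ] H),
          (φ A : H →L[ℂ] H) = -(U.comp ((A : H →L[ℂ] H).comp (conjAdjoint U)))))) := by
  rcases map_one_eq_one_or_neg_one hbij.2 hnorm with hone | hone
  · rcases exists_unitary_or_antiunitary_of_map_one hbij hnorm hone with
      ⟨U, hU, h⟩ | ⟨U, hU, h⟩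
    · exact .inl ⟨U, hU, .inl h⟩
    · exact .inr ⟨U, hU, .inl h⟩
  · rcases exists_unitary_or_antiunitary_of_map_one_eq_neg_one hbij hnorm hone with
      ⟨U, hU, h⟩ | ⟨U, hU, h⟩
    · exact .inl ⟨U, hU, .inr h⟩
    · exact .inr ⟨U, hU, .inr h⟩
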